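/- Let $\ell \ge 2$ be an integer, and let $(F_n^{(\ell)})_{n \ge 2-\ell}$ be the $\ell$-generalized Fibonacci sequence: $F_{2-\ell}^{(\ell)} = \cdots = F_0^{(\ell)} = 0$, $F_1^{(\ell)} = 1$, and $F_n^{(\ell)} = F_{n-1}^{(\ell)} + \cdots + F_{n-\ell}^{(\ell)}$ for $n \ge 2$. The series $\sum_{n \ge 1} (F_n^{(\ell)})^{-s}$ converges absolutely for $\operatorname{Re}(s) > 0$ and has a unique meromorphic continuation $\zeta_{F^{(\ell)}}$ to $\mathbb{C}$. If $m$ is a positive integer such that $-m$ is not a pole of $\zeta_{F^{(\ell)}}$, then $\zeta_{F^{(\ell)}}(-m) \in \mathbb{Q}$. -/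

import Mathlib

/-- The `ℓ`-generalized Fibonacci numbers `F_n` for `n ≥ 0`: `F_0 = 0`, `F_1 = 1` and
`F_n = F_{n-1} + ⋯ + F_{n-ℓ}` for `n ≥ 2`. The initial values `F_{2-ℓ} = ⋯ = F_{-1} = F_0 = 0`
are encoded by the truncated subtraction: an index below `0` is read as `0`, and `F_0 = 0`. -/
def genFib (ℓ : ℕ) : ℕ → ℕ
  | 0 => 0
  | 1 => 1
  | n + 2 => ∑ i : Fin ℓ, genFib ℓ (n + 1 - (i : ℕ))
termination_by n => n
decreasing_by omega

/-- `Z` is the meromorphic continuation to `ℂ` of the Dirichlet-type series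
`∑_{n ≥ 1} 1 / F_n ^ s`, which has to converge (absolutely) to `Z s` for `Re s > 0`.
Normal form fixes the values of `Z`: it is analytic at every point that is not a pole
(and takes the conventional value `0` at the poles). -/
structure IsGenFibZeta (ℓ : ℕ) (Z : ℂ → ℂ) : Prop where
  meromorphic : MeromorphicNFOn Z Set.univ
  hasSum : ∀ s : ℂ, 0 < s.re → HasSum (fun n : ℕ => 1 / (genFib ℓ (n + 1) : ℂ) ^ s) (Z s)

/-- `Z` has a pole at `s`: its order of vanishing there is negative. -/
def HasPoleAt (Z : ℂ → ℂ) (s : ℂ) : Prop :=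
  meromorphicOrderAt Z s < 0

/-!
Write `p = X ^ ℓ - X ^ (ℓ - 1) - ⋯ - 1` for the characteristic polynomial of the recurrence. It is
irreducible, with one real root `β > 1` and all other roots in the open unit disc
(`exists_dominant_root`, `irreducible_fibPoly`), and
`F_{n+1} = ∑ c_x x ^ n`, summed over the roots `x` of `p`, with `c_x = x ^ (ℓ - 1) / p'(x)`
(`genFib_succ_eq`).

*Continuation.* Let `F_{n+1} = c β ^ n (1 + r_n)`, where `c` is the coefficient of `β` and
`r_n = O(β ^ (-n))`. Expanding `(1 + r_n) ^ (-s)` to order `K` and the powers of `r_n` into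
exponentials, the sum over `n` becomes a finite sum of geometric series, whose values are
meromorphic on `ℂ`, plus a remainder series that converges locally uniformly on `Re s > -K`
(`DominatedExpSum.cont`). By the identity theorem these functions agree for different `K`, and so
they glue to a meromorphic function on `ℂ` (`DominatedExpSum.exists_isContinuation`).

*Values at `-m`.* For `s = -m` and `K = m + 1` the expansion is the binomial theorem, so the
remainder vanishes there. The rest involves the products `x_1 ⋯ x_m` of `m` roots: the residue at
`-m` is `1 / log β` times the sum of `c_{x_1} ⋯ c_{x_m}` over all `m`-tuples of product `1`, and
if no product is `1` then the value is a natural number plus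
`∑ c_{x_1} ⋯ c_{x_m} w ^ N / (1 - w)` with `w = x_1 ⋯ x_m`. The latter is invariant under the
Galois group of `p`, hence rational (`exists_rat_eq_sum_prod`).

*Cancellation of poles is impossible.* If individual terms could have poles that cancel, the
finite part would involve logarithms. But in a product of roots of `p` that equals `1` all roots
occur equally often (`exists_card_eq_of_prod_eq_one`): move a root of maximal multiplicity to `β`
by a Galois automorphism and compare absolute values, using that the product of all roots is `±1`.
So all terms of the residue are equal and nonzero, and the absence of a pole means that no product
of `m` roots is `1` (`prod_ne_one_of_sum_eq_zero`).
-/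

section Analysis

open Filter Topology Complex

/-! ### The binomial series with a uniform remainder -/

/-- The polynomial `z (z - 1) ⋯ (z - k + 1) / k!`. -/
noncomputable def binomPoly (z : ℂ) (k : ℕ) : ℂ :=
  ∏ j ∈ Finset.range k, (z - j) / (j + 1)

theorem binomPoly_succ (z : ℂ) (k : ℕ) :
    binomPoly z (k + 1) = binomPoly z k * ((z - k) / (k + 1)) := by
  simp only [binomPoly, Finset.prod_range_succ]

theorem choose_eq_binomPoly (z : ℂ) (k : ℕ) : Ring.choose z k = binomPoly z k := by
  induction k with
  | zero => simp [binomPoly]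
  | succ k ih =>
    have h1 : ((k + 1).factorial : ℂ) * Ring.choose z (k + 1)
        = (descPochhammer ℤ (k + 1)).smeval z := by
      rw [Ring.descPochhammer_eq_factorial_smul_choose, nsmul_eq_mul]
    have h2 : ((k).factorial : ℂ) * Ring.choose z k = (descPochhammer ℤ k).smeval z := by
      rw [Ring.descPochhammer_eq_factorial_smul_choose, nsmul_eq_mul]
    rw [descPochhammer_succ_right, Polynomial.smeval_mul, ← h2] at h1
    have h3 : ((k.factorial : ℕ) : ℂ) ≠ 0 := by exact_mod_cast k.factorial_ne_zero
    have h4 : (k + 1 : ℂ) ≠ 0 := by exact_mod_cast k.succ_ne_zero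
    rw [binomPoly_succ, ← ih]
    simp [Nat.factorial_succ, Polynomial.smeval_sub, Polynomial.smeval_natCast] at h1
    field_simp
    apply mul_left_cancel₀ h3
    linear_combination h1

theorem binomPoly_natCast (m k : ℕ) : binomPoly m k = (m.choose k : ℂ) := by
  rw [← choose_eq_binomPoly, Ring.choose_natCast]

theorem differentiable_binomPoly (k : ℕ) : Differentiable ℂ (fun z ↦ binomPoly z k) := by
  unfold binomPoly
  fun_prop

theorem norm_binomPoly_le {z : ℂ} {R : ℕ} (hz : ‖z‖ ≤ R) (k : ℕ) :
    ‖binomPoly z k‖ ≤ (R + k).choose k := by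
  induction k with
  | zero => simp [binomPoly]
  | succ k ih =>
    have h1 : ‖(z - k) / (k + 1 : ℂ)‖ ≤ (R + k + 1) / (k + 1) := by
      rw [norm_div]
      have : ‖(k + 1 : ℂ)‖ = k + 1 := by exact_mod_cast Complex.norm_natCast (k + 1)
      rw [this]
      gcongr
      calc ‖z - k‖ ≤ ‖z‖ + ‖(k : ℂ)‖ := norm_sub_le _ _
        _ ≤ R + k + 1 := by simp; linarith
    have h2 : (((R + (k + 1)).choose (k + 1) : ℕ) : ℝ)
        = (R + k).choose k * ((R + k + 1) / (k + 1)) := by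
      have := Nat.add_one_mul_choose_eq (R + k) k
      have h : ((R : ℝ) + k + 1) * ((R + k).choose k)
          = ((R + k + 1).choose (k + 1)) * (k + 1) := by exact_mod_cast this
      rw [← add_assoc]
      field_simp
      linarith
    rw [binomPoly_succ, norm_mul, h2]
    gcongr

theorem hasSum_binomPoly {z x : ℂ} (hx : ‖x‖ < 1) :
    HasSum (fun k ↦ binomPoly z k * x ^ k) ((1 + x) ^ z) := by
  have h := (one_add_cpow_hasFPowerSeriesOnBall_zero (a := z)).hasSum (y := x)
    (by simpa [Metric.mem_eball, edist_zero_right, enorm_eq_nnnorm, ← NNReal.coe_lt_coe] using hx)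
  rw [zero_add] at h
  refine h.congr_fun fun k ↦ ?_
  rw [binomialSeries_apply, choose_eq_binomPoly]
  simp

/-- The Taylor remainder of `(1 + x) ^ z`, uniformly for `z` in a bounded set. The radius `1 / 4` is
small enough for the bound `2 ^ (R + k)` on the `k`-th binomial coefficient. -/
theorem norm_cpow_sub_taylor_le {z x : ℂ} {R : ℕ} (hz : ‖z‖ ≤ R) (hx : ‖x‖ ≤ 1 / 4) (K : ℕ) :
    ‖(1 + x) ^ z - ∑ k ∈ Finset.range K, binomPoly z k * x ^ k‖ ≤ 2 ^ (R + 1) * (2 * ‖x‖) ^ K := by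
  have h := hasSum_binomPoly (z := z) (x := x) (by linarith)
  have h1 := (hasSum_nat_add_iff' K).2 h
  rw [← h1.tsum_eq]
  have hgeo : HasSum (fun n : ℕ ↦ 2 ^ R * (2 * ‖x‖) ^ K * (1 / 2 : ℝ) ^ n)
      (2 ^ R * (2 * ‖x‖) ^ K * 2) := hasSum_geometric_two.mul_left _
  refine (tsum_of_norm_bounded hgeo fun n ↦ ?_).trans (le_of_eq (by ring))
  rw [norm_mul, norm_pow]
  have hb : ‖binomPoly z (n + K)‖ ≤ 2 ^ (R + (n + K)) := by
    refine (norm_binomPoly_le hz _).trans ?_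
    exact_mod_cast Nat.choose_le_two_pow _ _
  calc ‖binomPoly z (n + K)‖ * ‖x‖ ^ (n + K) ≤ 2 ^ (R + (n + K)) * ‖x‖ ^ (n + K) := by gcongr
    _ = 2 ^ R * (2 * ‖x‖) ^ K * (2 * ‖x‖) ^ n := by ring
    _ ≤ 2 ^ R * (2 * ‖x‖) ^ K * (1 / 2 : ℝ) ^ n := by
      gcongr
      linarith

/-! ### Dirichlet series of dominated exponential sums -/

theorem ofReal_pow_cpow {x : ℝ} (hx : 0 ≤ x) (n : ℕ) (s : ℂ) :
    ((x ^ n : ℝ) : ℂ) ^ s = ((x : ℂ) ^ s) ^ n := by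
  induction n with
  | zero => simp
  | succ n ih => rw [pow_succ, ofReal_mul, mul_cpow_ofReal_nonneg (by positivity) hx, ih, pow_succ]

/-- A sequence of positive reals `a n = c β ^ n + ∑ i, d i * w i ^ n` with a dominant term:
`c > 0`, `β > 1`, and all other bases in the closed unit disc. -/
structure DominatedExpSum (ι : Type) [Fintype ι] where
  /-- the sequence -/
  a : ℕ → ℝ
  /-- coefficient of the dominant exponential -/
  c : ℝ
  /-- base of the dominant exponential -/
  β : ℝ
  /-- coefficients of the other exponentials -/
  d : ι → ℂ
  /-- bases of the other exponentials -/
  w : ι → ℂ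
  a_pos : ∀ n, 0 < a n
  c_pos : 0 < c
  one_lt_β : 1 < β
  norm_w_le : ∀ i, ‖w i‖ ≤ 1
  a_eq : ∀ n, (a n : ℂ) = c * β ^ n + ∑ i, d i * w i ^ n

namespace DominatedExpSum

variable {ι : Type} [Fintype ι] (D : DominatedExpSum ι)

theorem β_pos : 0 < D.β := one_pos.trans D.one_lt_β

theorem β_ne_zero : (D.β : ℂ) ≠ 0 := by exact_mod_cast D.β_pos.ne'

theorem c_ne_zero : (D.c : ℂ) ≠ 0 := by exact_mod_cast D.c_pos.ne'

/-- The relative error `a n / (c β ^ n) - 1` of the dominant term. -/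
noncomputable def r (n : ℕ) : ℂ := ∑ i, D.d i / D.c * (D.w i / D.β) ^ n

theorem a_eq_mul (n : ℕ) : (D.a n : ℂ) = D.c * D.β ^ n * (1 + D.r n) := by
  have h1 := D.c_ne_zero
  have h2 := D.β_ne_zero
  rw [D.a_eq, mul_add, mul_one, r, Finset.mul_sum]
  congr 1
  refine Finset.sum_congr rfl fun i _ ↦ ?_
  rw [div_pow]
  field_simp

theorem norm_r_le (n : ℕ) : ‖D.r n‖ ≤ (∑ i, ‖D.d i‖ / D.c) * (D.β⁻¹) ^ n := by
  rw [r, Finset.sum_mul]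
  refine (norm_sum_le _ _).trans (Finset.sum_le_sum fun i _ ↦ ?_)
  rw [norm_mul, norm_div, norm_pow, norm_div]
  have h1 := D.c_pos
  have h2 := D.β_pos
  simp only [norm_real, Real.norm_eq_abs, abs_of_pos h1, abs_of_pos h2]
  gcongr
  rw [inv_eq_one_div]
  gcongr
  exact D.norm_w_le i

theorem exists_norm_r_le : ∃ N, ∀ n, N ≤ n → ‖D.r n‖ ≤ 1 / 4 := by
  have h : Tendsto (fun n ↦ (∑ i, ‖D.d i‖ / D.c) * (D.β⁻¹) ^ n) atTop (𝓝 0) := by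
    simpa using (tendsto_pow_atTop_nhds_zero_of_lt_one (inv_nonneg.2 D.β_pos.le)
      (inv_lt_one_of_one_lt₀ D.one_lt_β)).const_mul (∑ i, ‖D.d i‖ / D.c)
  obtain ⟨N, hN⟩ := eventually_atTop.1 (h.eventually_le_const (show (0 : ℝ) < 1 / 4 by norm_num))
  exact ⟨N, fun n hn ↦ (D.norm_r_le n).trans (hN n hn)⟩

/-- An index from which on the relative error is at most `1 / 4`. -/
noncomputable def N : ℕ := D.exists_norm_r_le.choose

theorem norm_r_le_quarter {n : ℕ} (hn : D.N ≤ n) : ‖D.r n‖ ≤ 1 / 4 :=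
  D.exists_norm_r_le.choose_spec n hn

theorem cpow_eq (n : ℕ) (s : ℂ) :
    (D.a n : ℂ) ^ (-s) = (D.c : ℂ) ^ (-s) * ((D.β : ℂ) ^ (-s)) ^ n * (1 + D.r n) ^ (-s) := by
  have hc := D.c_pos
  have hβ := D.β_pos
  set q : ℝ := D.a n / (D.c * D.β ^ n) with hq
  have hq0 : 0 < q := div_pos (D.a_pos n) (by positivity)
  have hr : 1 + D.r n = (q : ℂ) := by
    have h1 := D.c_ne_zero
    have h2 := D.β_ne_zero
    rw [hq]
    push_cast
    rw [D.a_eq_mul]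
    field_simp
  rw [D.a_eq_mul, hr, show (D.c * D.β ^ n * q : ℂ) = ((D.c * D.β ^ n : ℝ) : ℂ) * (q : ℂ) by
    push_cast; ring, Complex.mul_cpow_ofReal_nonneg (by positivity) hq0.le, ofReal_mul,
    Complex.mul_cpow_ofReal_nonneg (by positivity) (by positivity)]
  congr 2
  exact ofReal_pow_cpow hβ.le n _

/-- The ratio of the geometric series in `n` that the monomial `f` of `(D.r n) ^ k` contributes. -/
noncomputable def ratio {k : ℕ} (f : Fin k → ι) (s : ℂ) : ℂ :=
  (D.β : ℂ) ^ (-s) * (∏ j, D.w (f j)) / D.β ^ k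

/-- The coefficient of the monomial `f` in the expansion of `(D.r n) ^ k`. -/
noncomputable def coef {k : ℕ} (f : Fin k → ι) : ℂ := (∏ j, D.d (f j)) / D.c ^ k

/-- For fixed `k` and `s`, the `k`-th term of the expansion is a sum of geometric
sequences in `n`. -/
theorem pow_mul_r_pow (k n : ℕ) (s : ℂ) :
    ((D.β : ℂ) ^ (-s)) ^ n * D.r n ^ k = ∑ f : Fin k → ι, D.coef f * D.ratio f s ^ n := by
  rw [r, Fintype.sum_pow, Finset.mul_sum]
  refine Finset.sum_congr rfl fun f _ ↦ ?_
  simp only [coef, ratio, Finset.prod_mul_distrib, Finset.prod_div_distrib, Finset.prod_const,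
    Finset.card_univ, Fintype.card_fin, Finset.prod_pow, div_pow, mul_pow]
  rw [← pow_mul, ← pow_mul, mul_comm n k]
  ring

/-- The error of the Taylor expansion of order `K` of `(a n) ^ (-s)` in the relative error. -/
noncomputable def rem (K n : ℕ) (s : ℂ) : ℂ :=
  (D.a n : ℂ) ^ (-s) - ∑ k ∈ Finset.range K,
    binomPoly (-s) k * ((D.c : ℂ) ^ (-s) * (((D.β : ℂ) ^ (-s)) ^ n * D.r n ^ k))

theorem rem_eq (K n : ℕ) (s : ℂ) : D.rem K n s = (D.c : ℂ) ^ (-s) * ((D.β : ℂ) ^ (-s)) ^ n *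
    ((1 + D.r n) ^ (-s) - ∑ k ∈ Finset.range K, binomPoly (-s) k * D.r n ^ k) := by
  rw [rem, cpow_eq, mul_sub, Finset.mul_sum]
  congr 1
  exact Finset.sum_congr rfl fun k _ ↦ by ring

theorem differentiable_ofReal_cpow_neg {x : ℝ} (hx : 0 < x) :
    Differentiable ℂ (fun s : ℂ ↦ (x : ℂ) ^ (-s)) := by
  have : (x : ℂ) ≠ 0 := by exact_mod_cast hx.ne'
  intro s
  exact (differentiableAt_id.neg).const_cpow (Or.inl this)

theorem differentiable_rem (K n : ℕ) : Differentiable ℂ (D.rem K n) := by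
  unfold rem
  refine (differentiable_ofReal_cpow_neg (D.a_pos n)).sub (Differentiable.fun_sum fun k _ ↦ ?_)
  refine ((differentiable_binomPoly k).comp differentiable_neg).mul ?_
  refine (differentiable_ofReal_cpow_neg D.c_pos).mul (Differentiable.mul ?_ ?_)
  · exact (differentiable_ofReal_cpow_neg D.β_pos).pow n
  · exact differentiable_const _

theorem norm_ofReal_cpow_neg_le {x : ℝ} (hx : 0 < x) {s : ℂ} {R : ℝ} (hs : ‖s‖ ≤ R) :
    ‖(x : ℂ) ^ (-s)‖ ≤ Real.exp (|Real.log x| * R) := by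
  rw [norm_cpow_eq_rpow_re_of_pos hx, Real.rpow_def_of_pos hx]
  refine Real.exp_le_exp.2 ((le_abs_self _).trans ?_)
  rw [abs_mul]
  gcongr
  exact (abs_re_le_norm _).trans (by rwa [norm_neg])

/-- Locally uniformly in `s`, the remainder decays like `β ^ (-(Re s + K) n)`. -/
theorem norm_rem_le (K : ℕ) {n : ℕ} (hn : D.N ≤ n) {R : ℕ} {σ : ℝ} {s : ℂ} (hs : ‖s‖ ≤ R)
    (hσ : σ ≤ s.re) : ‖D.rem K n s‖ ≤ Real.exp (|Real.log D.c| * R) * (2 ^ (R + 1) *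
      (2 * ∑ i, ‖D.d i‖ / D.c) ^ K) * (D.β ^ (-(σ + K))) ^ n := by
  have hβ := D.β_pos
  have hc := D.c_pos
  have h1 : ‖((D.β : ℂ) ^ (-s)) ^ n‖ ≤ (D.β ^ (-σ)) ^ n := by
    rw [norm_pow, norm_cpow_eq_rpow_re_of_pos hβ]
    gcongr
    · exact D.one_lt_β.le
    · simpa using hσ
  have h2 := norm_cpow_sub_taylor_le (z := -s) (R := R) (by simpa using hs)
    (D.norm_r_le_quarter hn) K
  have h3 : (2 * ‖D.r n‖) ^ K ≤ (2 * ∑ i, ‖D.d i‖ / D.c) ^ K * ((D.β⁻¹) ^ K) ^ n := by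
    rw [← pow_mul, mul_comm K n, pow_mul, ← mul_pow, mul_assoc]
    gcongr
    exact D.norm_r_le n
  have h4 : D.β ^ (-(σ + K)) = D.β ^ (-σ) * (D.β⁻¹) ^ K := by
    rw [neg_add, Real.rpow_add hβ, Real.rpow_neg hβ.le (K : ℝ), Real.rpow_natCast, inv_pow]
  have h5 : 0 ≤ ∑ i, ‖D.d i‖ / D.c := Finset.sum_nonneg fun i _ ↦ by positivity
  rw [rem_eq, norm_mul, norm_mul, h4, mul_pow]
  calc _ ≤ Real.exp (|Real.log D.c| * R) * (D.β ^ (-σ)) ^ n * (2 ^ (R + 1) *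
        ((2 * ∑ i, ‖D.d i‖ / D.c) ^ K * ((D.β⁻¹) ^ K) ^ n)) := by
        gcongr
        · exact norm_ofReal_cpow_neg_le hc hs
        · exact h2.trans (by gcongr)
    _ = _ := by ring

theorem summable_norm_rem_bound (K : ℕ) {σ : ℝ} (hσ : -(K : ℝ) < σ) (M : ℝ) :
    Summable fun j : ℕ ↦ M * (D.β ^ (-(σ + K))) ^ (j + D.N) := by
  have hlt : D.β ^ (-(σ + K)) < 1 := Real.rpow_lt_one_of_one_lt_of_neg D.one_lt_β (by linarith)
  exact (((summable_nat_add_iff D.N).2 (summable_geometric_of_lt_one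
    (Real.rpow_nonneg D.β_pos.le _) hlt))).mul_left M

theorem summable_rem (K : ℕ) {s : ℂ} (hs : -(K : ℝ) < s.re) :
    Summable fun j ↦ D.rem K (j + D.N) s :=
  Summable.of_norm_bounded (D.summable_norm_rem_bound K hs _)
    fun _ ↦ D.norm_rem_le K (Nat.le_add_left _ _) (Nat.le_ceil ‖s‖) le_rfl

theorem isOpen_lt_re (x : ℝ) : IsOpen {s : ℂ | x < s.re} :=
  isOpen_lt continuous_const continuous_re

theorem analyticAt_tsum_rem (K : ℕ) {s : ℂ} (hs : -(K : ℝ) < s.re) :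
    AnalyticAt ℂ (fun z ↦ ∑' j, D.rem K (j + D.N) z) s := by
  obtain ⟨σ, h1, h2⟩ := exists_between hs
  set V : Set ℂ := Metric.ball s 1 ∩ {z | σ < z.re}
  have hV : IsOpen V := Metric.isOpen_ball.inter (isOpen_lt_re σ)
  have hsV : s ∈ V := ⟨Metric.mem_ball_self one_pos, h2⟩
  have hd : DifferentiableOn ℂ (fun z ↦ ∑' j, D.rem K (j + D.N) z) V := by
    refine differentiableOn_tsum_of_summable_norm (D.summable_norm_rem_bound K h1 _)
      (fun j ↦ (D.differentiable_rem K _).differentiableOn) hV (fun _ z hz ↦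
        D.norm_rem_le K (R := ⌈‖s‖ + 1⌉₊) (Nat.le_add_left _ _) ?_ (le_of_lt hz.2))
    refine le_trans ?_ (Nat.le_ceil _)
    have := mem_ball_iff_norm.1 hz.1
    linarith [norm_le_norm_add_norm_sub' z s]
  exact hd.analyticAt (hV.mem_nhds hsV)

/-- The contribution of one monomial of the Taylor expansion, summed over `n ≥ N`. Where the ratio
is `1`, which is where poles can occur, the value `0` of this formula has no meaning. -/
noncomputable def term {k : ℕ} (f : Fin k → ι) (s : ℂ) : ℂ :=
  binomPoly (-s) k * ((D.c : ℂ) ^ (-s) * (D.coef f * (D.ratio f s ^ D.N / (1 - D.ratio f s))))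

/-- The continuation of `∑ (a n) ^ (-s)` to the half-plane `Re s > -K`. The finitely many terms
with `n < N`, for which the relative error may be large, are not expanded. -/
noncomputable def cont (K : ℕ) (s : ℂ) : ℂ :=
  ∑ n ∈ Finset.range D.N, (D.a n : ℂ) ^ (-s) +
    (∑ k ∈ Finset.range K, ∑ f : Fin k → ι, D.term f s + ∑' j, D.rem K (j + D.N) s)

theorem norm_ratio_lt_one {k : ℕ} (f : Fin k → ι) {s : ℂ} (hs : 0 < s.re) : ‖D.ratio f s‖ < 1 := by
  have hβ := D.β_pos
  rw [ratio, norm_div, norm_mul, norm_cpow_eq_rpow_re_of_pos hβ, norm_prod, norm_pow, norm_real,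
    Real.norm_eq_abs, abs_of_pos hβ, neg_re]
  have h1 : D.β ^ (-s.re) < 1 := Real.rpow_lt_one_of_one_lt_of_neg D.one_lt_β (by linarith)
  have h2 : ∏ j, ‖D.w (f j)‖ ≤ 1 := Finset.prod_le_one (fun _ _ ↦ norm_nonneg _)
    fun _ _ ↦ D.norm_w_le _
  have h3 : 1 ≤ D.β ^ k := one_le_pow₀ D.one_lt_β.le
  rw [div_lt_one (by positivity)]
  have h4 : 0 ≤ D.β ^ (-s.re) := by positivity
  nlinarith

theorem hasSum_cont (K : ℕ) {s : ℂ} (hs : 0 < s.re) :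
    HasSum (fun n ↦ (D.a n : ℂ) ^ (-s)) (D.cont K s) := by
  rw [cont, add_comm (∑ n ∈ Finset.range D.N, (D.a n : ℂ) ^ (-s)),
    ← hasSum_nat_add_iff (f := fun n ↦ (D.a n : ℂ) ^ (-s)) D.N]
  have hrem := (D.summable_rem K (s := s) (by linarith [(Nat.cast_nonneg K : (0 : ℝ) ≤ K)])).hasSum
  have hterm : HasSum (fun j : ℕ ↦ ∑ k ∈ Finset.range K, ∑ f : Fin k → ι, binomPoly (-s) k *
      ((D.c : ℂ) ^ (-s) * (D.coef f * D.ratio f s ^ (j + D.N))))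
      (∑ k ∈ Finset.range K, ∑ f : Fin k → ι, D.term f s) := by
    refine hasSum_sum fun k _ ↦ hasSum_sum fun f _ ↦ ?_
    unfold term
    refine ((HasSum.mul_left _ ?_).mul_left _).mul_left _
    have := (hasSum_geometric_of_norm_lt_one (D.norm_ratio_lt_one f hs)).mul_left
      (D.ratio f s ^ D.N)
    simpa only [div_eq_mul_inv, pow_add, mul_comm (D.ratio f s ^ D.N)] using this
  refine (hterm.add hrem).congr_fun fun j ↦ ?_
  rw [rem]
  simp only [pow_mul_r_pow, Finset.mul_sum]
  ring

theorem differentiable_ratio {k : ℕ} (f : Fin k → ι) : Differentiable ℂ (D.ratio f) := by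
  unfold ratio
  exact ((differentiable_ofReal_cpow_neg D.β_pos).mul (differentiable_const _)).div_const _

theorem meromorphicAt_term {k : ℕ} (f : Fin k → ι) (s : ℂ) : MeromorphicAt (D.term f) s := by
  unfold term
  have h1 := ((D.differentiable_ratio f).analyticAt s).meromorphicAt
  have h2 := (((differentiable_binomPoly k).comp differentiable_neg).analyticAt s).meromorphicAt
  have h3 := ((differentiable_ofReal_cpow_neg D.c_pos).analyticAt s).meromorphicAt
  refine h2.mul (h3.mul ((MeromorphicAt.const _ _).mul ((h1.pow _).div ?_)))
  exact (MeromorphicAt.const _ _).sub h1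

theorem meromorphicAt_cont (K : ℕ) {s : ℂ} (hs : -(K : ℝ) < s.re) :
    MeromorphicAt (D.cont K) s := by
  unfold cont
  refine MeromorphicAt.add ?_ (MeromorphicAt.add ?_ (D.analyticAt_tsum_rem K hs).meromorphicAt)
  · exact MeromorphicAt.fun_sum fun n _ ↦
      ((differentiable_ofReal_cpow_neg (D.a_pos n)).analyticAt s).meromorphicAt
  · exact MeromorphicAt.fun_sum fun k _ ↦ MeromorphicAt.fun_sum fun f _ ↦ D.meromorphicAt_term f s

end DominatedExpSum

/-! ### Gluing the continuations -/

/-- Identity theorem on a half-plane containing the right half-plane. -/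
theorem eventuallyEq_nhdsNE_of_eq_of_re_pos {x : ℝ} (hx : x ≤ 0) {f g : ℂ → ℂ}
    (hf : ∀ s : ℂ, x < s.re → MeromorphicAt f s) (hg : ∀ s : ℂ, x < s.re → MeromorphicAt g s)
    (h : ∀ s : ℂ, 0 < s.re → f s = g s) {s : ℂ} (hs : x < s.re) : f =ᶠ[𝓝[≠] s] g := by
  have hU : IsConnected {s : ℂ | x < s.re} :=
    ⟨⟨s, hs⟩, (convex_halfSpace_re_gt x).isPreconnected⟩
  have hm : MeromorphicOn (f - g) {s : ℂ | x < s.re} := fun z hz ↦ (hf z hz).sub (hg z hz)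
  have h1 : meromorphicOrderAt (f - g) 1 = ⊤ := by
    rw [meromorphicOrderAt_eq_top_iff]
    refine Filter.Eventually.filter_mono nhdsWithin_le_nhds ?_
    filter_upwards [(DominatedExpSum.isOpen_lt_re 0).mem_nhds (show (0 : ℝ) < (1 : ℂ).re by simp)]
      with z hz
    simp [h z hz]
  have h2 : meromorphicOrderAt (f - g) s = ⊤ := by
    by_contra hne
    have := (hm.exists_meromorphicOrderAt_ne_top_iff_forall_mem hU).1 ⟨s, hs, hne⟩ 1
      (show x < (1 : ℂ).re by simp; linarith)
    exact this h1
  rw [meromorphicOrderAt_eq_top_iff] at h2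
  filter_upwards [h2] with z hz
  exact sub_eq_zero.1 hz

namespace DominatedExpSum

variable {ι : Type} [Fintype ι] (D : DominatedExpSum ι)

theorem cont_eventuallyEq {f : ℂ → ℂ} {K : ℕ}
    (hf : ∀ s : ℂ, -(K : ℝ) < s.re → MeromorphicAt f s)
    (h : ∀ s : ℂ, 0 < s.re → HasSum (fun n ↦ (D.a n : ℂ) ^ (-s)) (f s))
    {s : ℂ} (hs : -(K : ℝ) < s.re) : f =ᶠ[𝓝[≠] s] D.cont K :=
  eventuallyEq_nhdsNE_of_eq_of_re_pos (by simp) hf (fun _ h ↦ D.meromorphicAt_cont K h)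
    (fun s hs ↦ (h s hs).unique (D.hasSum_cont K hs)) hs

/-- The continuations to the half-planes, glued together: every point uses a half-plane that
contains a neighbourhood of it. At poles the values are arbitrary. -/
noncomputable def glue (s : ℂ) : ℂ := D.cont (⌈‖s‖⌉₊ + 1) s

/-- Near `s` only finitely many of the continuations occur in `glue`, and any two of them agree in a
punctured neighbourhood of `s`. -/
theorem glue_eventuallyEq (s : ℂ) : D.glue =ᶠ[𝓝[≠] s] D.cont (⌈‖s‖ + 1⌉₊ + 1) := by
  set M := ⌈‖s‖ + 1⌉₊ + 1
  have hre : -‖s‖ ≤ s.re := (abs_le.1 (abs_re_le_norm s)).1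
  have h1 : ∀ᶠ z in 𝓝[≠] s, ∀ j ∈ Finset.range (M + 1), -(j : ℝ) < s.re →
      D.cont j z = D.cont M z := by
    rw [Finset.eventually_all]
    intro j hj
    by_cases hjs : -(j : ℝ) < s.re
    · have hjM : (j : ℝ) ≤ M := by exact_mod_cast Nat.lt_succ_iff.1 (Finset.mem_range.1 hj)
      have := D.cont_eventuallyEq (f := D.cont M) (K := j)
        (fun z hz ↦ D.meromorphicAt_cont M (by linarith)) (fun z hz ↦ D.hasSum_cont M hz) hjs
      filter_upwards [this] with z hz _
      exact hz.symm
    · exact Eventually.of_forall fun z h ↦ absurd h hjs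
  have h2 : ∀ᶠ z in 𝓝[≠] s, z ∈ Metric.ball s 1 :=
    nhdsWithin_le_nhds (Metric.ball_mem_nhds s one_pos)
  filter_upwards [h1, h2] with z hz hz1
  rw [mem_ball_iff_norm] at hz1
  refine hz _ (Finset.mem_range.2 ?_) ?_
  · have : ⌈‖z‖⌉₊ ≤ ⌈‖s‖ + 1⌉₊ := Nat.ceil_le_ceil (by linarith [norm_le_norm_add_norm_sub' z s])
    omega
  · have h3 := Nat.le_ceil ‖z‖
    have h4 := norm_le_norm_add_norm_sub' s z
    rw [norm_sub_rev] at h4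
    push_cast
    linarith

theorem meromorphicAt_glue (s : ℂ) : MeromorphicAt D.glue s := by
  refine (D.meromorphicAt_cont (⌈‖s‖ + 1⌉₊ + 1) ?_).congr (D.glue_eventuallyEq s).symm
  have hre : -‖s‖ ≤ s.re := (abs_le.1 (abs_re_le_norm s)).1
  have := Nat.le_ceil (‖s‖ + 1)
  push_cast
  linarith

theorem hasSum_glue {s : ℂ} (hs : 0 < s.re) : HasSum (fun n ↦ (D.a n : ℂ) ^ (-s)) (D.glue s) :=
  D.hasSum_cont _ hs

theorem analyticAt_glue {s : ℂ} (hs : 0 < s.re) : AnalyticAt ℂ D.glue s := by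
  -- for `K = 0` nothing is expanded, and the continuation is the series itself
  have h0 : AnalyticAt ℂ (D.cont 0) s := by
    unfold cont
    refine AnalyticAt.add ?_ (AnalyticAt.add ?_ (D.analyticAt_tsum_rem 0 (by simpa using hs)))
    · exact Finset.analyticAt_fun_sum _ fun n _ ↦
        (differentiable_ofReal_cpow_neg (D.a_pos n)).analyticAt s
    · simpa using analyticAt_const
  refine h0.congr ?_
  filter_upwards [(isOpen_lt_re 0).mem_nhds hs] with z hz
  exact (D.hasSum_cont 0 hz).unique (D.hasSum_glue hz)

/-- `Z` is the meromorphic continuation, in normal form, of `∑ (a n) ^ (-s)`. -/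
structure IsContinuation (Z : ℂ → ℂ) : Prop where
  meromorphic : MeromorphicNFOn Z Set.univ
  hasSum : ∀ s : ℂ, 0 < s.re → HasSum (fun n ↦ (D.a n : ℂ) ^ (-s)) (Z s)

theorem exists_isContinuation : ∃ Z, D.IsContinuation Z := by
  have hm : MeromorphicOn D.glue Set.univ := fun s _ ↦ D.meromorphicAt_glue s
  refine ⟨toMeromorphicNFOn D.glue Set.univ, meromorphicNFOn_toMeromorphicNFOn _ _, fun s hs ↦ ?_⟩
  rw [toMeromorphicNFOn_eq_toMeromorphicNFAt hm (Set.mem_univ s),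
    toMeromorphicNFAt_eq_self.2 (D.analyticAt_glue hs).meromorphicNFAt]
  exact D.hasSum_glue hs

variable {D}

theorem IsContinuation.eventuallyEq_cont {Z : ℂ → ℂ} (hZ : D.IsContinuation Z) {K : ℕ} {s : ℂ}
    (hs : -(K : ℝ) < s.re) : Z =ᶠ[𝓝[≠] s] D.cont K :=
  D.cont_eventuallyEq (fun z _ ↦ (hZ.meromorphic (Set.mem_univ z)).meromorphicAt) hZ.hasSum hs

theorem IsContinuation.unique {Z Z' : ℂ → ℂ} (hZ : D.IsContinuation Z)
    (hZ' : D.IsContinuation Z') : Z = Z' := by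
  funext s
  have h := eventuallyEq_nhdsNE_of_eq_of_re_pos (x := min 0 (s.re - 1)) (min_le_left _ _)
    (fun z _ ↦ (hZ.meromorphic (Set.mem_univ z)).meromorphicAt)
    (fun z _ ↦ (hZ'.meromorphic (Set.mem_univ z)).meromorphicAt)
    (fun z hz ↦ (hZ.hasSum z hz).unique (hZ'.hasSum z hz)) (s := s)
    ((min_le_right _ _).trans_lt (by linarith))
  exact (((hZ.meromorphic (Set.mem_univ s)).eventuallyEq_nhdsNE_iff_eventuallyEq_nhds
    (hZ'.meromorphic (Set.mem_univ s))).1 h).self_of_nhds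

/-! ### Residues and values at negative integers -/

variable (D)

/-- At `s = -m` the expansion is the finite binomial theorem, so there is no remainder. -/
theorem rem_neg_natCast {m K : ℕ} (hm : m < K) (n : ℕ) : D.rem K n (-(m : ℂ)) = 0 := by
  rw [rem_eq, mul_eq_zero]
  right
  rw [neg_neg, cpow_natCast, add_comm, add_pow, sub_eq_zero]
  have : Finset.range (m + 1) ⊆ Finset.range K := Finset.range_subset_range.2 hm
  rw [← Finset.sum_subset this]
  · refine Finset.sum_congr rfl fun k _ ↦ ?_
    rw [binomPoly_natCast]
    ring
  · intro k _ hk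
    rw [binomPoly_natCast, Nat.choose_eq_zero_of_lt (by simpa using hk)]
    simp

/-- For a function `φ`, the sum of `A φ(x)` over the exponential terms `A x ^ n` of the expansion
of `(a n) ^ m`, expanded around the dominant term. -/
noncomputable def powSum (m : ℕ) (φ : ℂ → ℂ) : ℂ :=
  ∑ k ∈ Finset.range (m + 1), ∑ f : Fin k → ι,
    binomPoly m k * ((D.c : ℂ) ^ m * (D.coef f * φ (D.ratio f (-(m : ℂ)))))

theorem hasDerivAt_ratio {k : ℕ} (f : Fin k → ι) (s : ℂ) :
    HasDerivAt (D.ratio f) (-(Real.log D.β) * D.ratio f s) s := by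
  have h := ((((hasDerivAt_id s).neg.const_cpow (c := (D.β : ℂ)) (Or.inl D.β_ne_zero)).mul_const
    (∏ j, D.w (f j))).div_const ((D.β : ℂ) ^ k))
  refine h.congr_deriv ?_
  rw [ratio, ← ofReal_log D.β_pos.le]
  simp only [id, Pi.neg_apply]
  ring

theorem log_β_ne_zero : (Real.log D.β : ℂ) ≠ 0 := by
  exact_mod_cast (Real.log_pos D.one_lt_β).ne'

/-- The residue of a single term: a pole occurs exactly where the ratio is `1`, and there the
ratio has derivative `-log β`. -/
theorem tendsto_mul_term {k : ℕ} (f : Fin k → ι) (s : ℂ) :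
    Tendsto (fun z ↦ (z - s) * D.term f z) (𝓝[≠] s) (𝓝 (binomPoly (-s) k * ((D.c : ℂ) ^ (-s) *
      (D.coef f * (if D.ratio f s = 1 then (Real.log D.β : ℂ)⁻¹ else 0))))) := by
  have h1 : Tendsto (fun z ↦ binomPoly (-z) k) (𝓝[≠] s) (𝓝 (binomPoly (-s) k)) :=
    (((differentiable_binomPoly k).comp differentiable_neg).continuous.tendsto s).mono_left
      nhdsWithin_le_nhds
  have h2 : Tendsto (fun z ↦ (D.c : ℂ) ^ (-z)) (𝓝[≠] s) (𝓝 ((D.c : ℂ) ^ (-s))) :=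
    ((differentiable_ofReal_cpow_neg D.c_pos).continuous.tendsto s).mono_left nhdsWithin_le_nhds
  have h3 : Tendsto (D.ratio f) (𝓝[≠] s) (𝓝 (D.ratio f s)) :=
    ((D.differentiable_ratio f).continuous.tendsto s).mono_left nhdsWithin_le_nhds
  have h0 : Tendsto (fun z ↦ z - s) (𝓝[≠] s) (𝓝 0) := by
    have : Tendsto (fun z ↦ z - s) (𝓝 s) (𝓝 (s - s)) :=
      (continuous_id.sub continuous_const).tendsto s
    rw [sub_self] at this
    exact this.mono_left nhdsWithin_le_nhds
  have h4 : Tendsto (fun z ↦ D.ratio f z ^ D.N * ((z - s) / (1 - D.ratio f z))) (𝓝[≠] s)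
      (𝓝 (if D.ratio f s = 1 then (Real.log D.β : ℂ)⁻¹ else 0)) := by
    split_ifs with h
    · have hd := hasDerivAt_iff_tendsto_slope.1 (D.hasDerivAt_ratio f s)
      rw [h, mul_one] at hd
      have hi := hd.neg.inv₀ (by simpa using D.log_β_ne_zero)
      have := (h3.pow D.N).mul hi
      rw [h, one_pow, one_mul, neg_neg] at this
      refine this.congr fun z ↦ ?_
      rw [slope_def_field, h, ← neg_div, inv_div, neg_sub]
    · have := (h3.pow D.N).mul (h0.div (tendsto_const_nhds.sub h3) (sub_ne_zero.2 (Ne.symm h)))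
      simpa using this
  refine (h1.mul (h2.mul (h4.const_mul (D.coef f)))).congr fun z ↦ ?_
  rw [term]
  ring

/-- The residue at `-m`. -/
theorem tendsto_mul_cont (m : ℕ) :
    Tendsto (fun z ↦ (z - -(m : ℂ)) * D.cont (m + 1) z) (𝓝[≠] (-(m : ℂ)))
      (𝓝 (D.powSum m fun x ↦ if x = 1 then (Real.log D.β : ℂ)⁻¹ else 0)) := by
  have h0 : Tendsto (fun z ↦ z - -(m : ℂ)) (𝓝[≠] (-(m : ℂ))) (𝓝 0) := by
    have : Tendsto (fun z ↦ z - -(m : ℂ)) (𝓝 (-(m : ℂ))) (𝓝 (-(m : ℂ) - -(m : ℂ))) :=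
      (continuous_id.sub continuous_const).tendsto _
    rw [sub_self] at this
    exact this.mono_left nhdsWithin_le_nhds
  have h1 : ContinuousAt (fun s : ℂ ↦ ∑ n ∈ Finset.range D.N, (D.a n : ℂ) ^ (-s)) (-(m : ℂ)) :=
    (Differentiable.fun_sum fun n _ ↦
      differentiable_ofReal_cpow_neg (D.a_pos n)).continuous.continuousAt
  have h2 := (D.analyticAt_tsum_rem (m + 1) (s := -(m : ℂ)) (by simp)).continuousAt
  have h3 := h0.mul ((h1.tendsto.add h2.tendsto).mono_left nhdsWithin_le_nhds)
  have h4 := tendsto_finsetSum (Finset.range (m + 1)) fun k _ ↦ tendsto_finsetSum Finset.univ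
    fun (f : Fin k → ι) _ ↦ D.tendsto_mul_term f (-(m : ℂ))
  have h5 := h4.add h3
  rw [zero_mul, add_zero] at h5
  simp only [neg_neg, cpow_natCast] at h5
  refine h5.congr fun z ↦ ?_
  simp only [cont, ← Finset.mul_sum]
  ring

/-- The value at `-m` when none of the terms has a pole there. -/
theorem tendsto_cont {m : ℕ}
    (h : ∀ k ≤ m, ∀ f : Fin k → ι, D.ratio f (-(m : ℂ)) ≠ 1) :
    Tendsto (D.cont (m + 1)) (𝓝 (-(m : ℂ)))
      (𝓝 (∑ n ∈ Finset.range D.N, (D.a n : ℂ) ^ m + D.powSum m fun x ↦ x ^ D.N / (1 - x))) := by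
  have h1 : Tendsto (fun s : ℂ ↦ ∑ n ∈ Finset.range D.N, (D.a n : ℂ) ^ (-s)) (𝓝 (-(m : ℂ)))
      (𝓝 (∑ n ∈ Finset.range D.N, (D.a n : ℂ) ^ (- -(m : ℂ)))) :=
    (Differentiable.fun_sum fun n _ ↦
      differentiable_ofReal_cpow_neg (D.a_pos n)).continuous.tendsto _
  have h2 := (D.analyticAt_tsum_rem (m + 1) (s := -(m : ℂ)) (by simp)).continuousAt.tendsto
  have h3 : Tendsto (fun s : ℂ ↦ ∑ k ∈ Finset.range (m + 1), ∑ f : Fin k → ι, D.term f s)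
      (𝓝 (-(m : ℂ))) (𝓝 (∑ k ∈ Finset.range (m + 1), ∑ f : Fin k → ι, D.term f (-(m : ℂ)))) := by
    refine tendsto_finsetSum _ fun k hk ↦ tendsto_finsetSum _ fun f _ ↦ ?_
    have h4 := h k (Nat.lt_succ_iff.1 (Finset.mem_range.1 hk)) f
    have h5 := (D.differentiable_ratio f).continuous.tendsto (-(m : ℂ))
    exact ((((differentiable_binomPoly k).comp differentiable_neg).continuous.tendsto _).mul
      (((differentiable_ofReal_cpow_neg D.c_pos).continuous.tendsto _).mul
        (((h5.pow _).div (tendsto_const_nhds.sub h5) (sub_ne_zero.2 h4.symm)).const_mul _)))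
  have h6 := h1.add (h3.add h2)
  simp only [D.rem_neg_natCast (Nat.lt_succ_self m), tsum_zero, add_zero, neg_neg, cpow_natCast,
    term] at h6
  exact h6

variable {D}

/-- If `-m` is not a pole, the residue vanishes. -/
theorem IsContinuation.powSum_eq_zero {Z : ℂ → ℂ} (hZ : D.IsContinuation Z) {m : ℕ}
    (hm : ¬ meromorphicOrderAt Z (-(m : ℂ)) < 0) :
    D.powSum m (fun x ↦ if x = 1 then (Real.log D.β : ℂ)⁻¹ else 0) = 0 := by
  have hZa := (hZ.meromorphic
    (Set.mem_univ (-(m : ℂ)))).meromorphicOrderAt_nonneg_iff_analyticAt.1 (not_lt.1 hm)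
  have h1 : Tendsto (fun z ↦ (z - -(m : ℂ)) * Z z) (𝓝[≠] (-(m : ℂ))) (𝓝 0) := by
    have : ContinuousAt (fun z ↦ (z - -(m : ℂ)) * Z z) (-(m : ℂ)) :=
      (continuousAt_id.sub continuousAt_const).mul hZa.continuousAt
    simpa using this.tendsto.mono_left (nhdsWithin_le_nhds (s := {-(m : ℂ)}ᶜ))
  refine tendsto_nhds_unique ((D.tendsto_mul_cont m).congr' ?_) h1
  filter_upwards [hZ.eventuallyEq_cont (K := m + 1) (s := -(m : ℂ)) (by simp)] with z hz
  rw [hz]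

theorem IsContinuation.apply_neg_natCast {Z : ℂ → ℂ} (hZ : D.IsContinuation Z) {m : ℕ}
    (hm : ¬ meromorphicOrderAt Z (-(m : ℂ)) < 0)
    (h : ∀ k ≤ m, ∀ f : Fin k → ι, D.ratio f (-(m : ℂ)) ≠ 1) :
    Z (-(m : ℂ)) =
      ∑ n ∈ Finset.range D.N, (D.a n : ℂ) ^ m + D.powSum m fun x ↦ x ^ D.N / (1 - x) := by
  have hZa := (hZ.meromorphic
    (Set.mem_univ (-(m : ℂ)))).meromorphicOrderAt_nonneg_iff_analyticAt.1 (not_lt.1 hm)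
  refine tendsto_nhds_unique (hZa.continuousAt.tendsto.mono_left
    (nhdsWithin_le_nhds (s := {-(m : ℂ)}ᶜ)))
    (((D.tendsto_cont h).mono_left nhdsWithin_le_nhds).congr' ?_)
  filter_upwards [hZ.eventuallyEq_cont (K := m + 1) (s := -(m : ℂ)) (by simp)] with z hz
  rw [hz]

end DominatedExpSum

/-! ### Regrouping the expansion by tuples of bases -/

theorem MonoidAlgebra.sum_single_pow {κ R G : Type*} [Fintype κ] [CommSemiring R] [CommMonoid G]
    (v : κ → G) (e : κ → R) (m : ℕ) :
    (∑ x, MonoidAlgebra.single (v x) (e x)) ^ m =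
      ∑ g : Fin m → κ, MonoidAlgebra.single (∏ j, v (g j)) (∏ j, e (g j)) := by
  rw [Fintype.sum_pow]
  exact Finset.sum_congr rfl fun g _ ↦ MonoidAlgebra.prod_single _ _ _

/-- The linear functional on the monoid algebra with `single x A ↦ A φ(x)`. -/
noncomputable def evalWith (φ : ℂ → ℂ) : MonoidAlgebra ℂ ℂ →ₗ[ℂ] ℂ :=
  Finsupp.linearCombination ℂ φ ∘ₗ (MonoidAlgebra.coeffLinearEquiv ℂ).toLinearMap

theorem evalWith_single (φ : ℂ → ℂ) (x A : ℂ) :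
    evalWith φ (MonoidAlgebra.single x A) = A * φ x := by
  simp [evalWith]

/-- The expansions of a power of `∑ x, e x [v x]` in the monoid algebra of `ℂ`, by tuples of
summands and by the binomial theorem with the summand `x₀` split off, have the same image under
`evalWith φ`. -/
theorem sum_prod_eq_sum_choose {κ : Type} [Fintype κ] [DecidableEq κ] (x₀ : κ) (v e : κ → ℂ)
    (φ : ℂ → ℂ) (m : ℕ) :
    ∑ g : Fin m → κ, (∏ j, e (g j)) * φ (∏ j, v (g j)) =
      ∑ k ∈ Finset.range (m + 1), ∑ f : Fin k → {x // x ≠ x₀},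
        (m.choose k : ℂ) * ((e x₀ ^ (m - k) * ∏ j, e (f j)) *
          φ (v x₀ ^ (m - k) * ∏ j, v (f j))) := by
  have h1 := MonoidAlgebra.sum_single_pow (G := ℂ) v e m
  have h2 : ∑ x, MonoidAlgebra.single (v x) (e x) =
      (∑ x : {x // x ≠ x₀}, MonoidAlgebra.single (v x) (e x)) +
        MonoidAlgebra.single (v x₀) (e x₀) := by
    rw [add_comm, Fintype.sum_eq_add_sum_subtype_ne (fun x ↦ MonoidAlgebra.single (v x) (e x)) x₀]
  rw [h2, add_pow] at h1
  have h3 := congrArg (evalWith φ) h1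
  simp only [map_sum, evalWith_single] at h3
  rw [← h3]
  refine Finset.sum_congr rfl fun k _ ↦ ?_
  rw [MonoidAlgebra.sum_single_pow (fun x : {x // x ≠ x₀} ↦ v x) (fun x ↦ e x),
    MonoidAlgebra.single_pow, mul_comm _ ((m.choose k : MonoidAlgebra ℂ ℂ)), ← nsmul_eq_mul,
    Finset.sum_mul, map_nsmul, map_sum, Finset.smul_sum]
  refine Finset.sum_congr rfl fun f _ ↦ ?_
  rw [MonoidAlgebra.single_mul_single, evalWith_single, nsmul_eq_mul,
    mul_comm (e x₀ ^ (m - k)), mul_comm (v x₀ ^ (m - k))]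

namespace DominatedExpSum

theorem ratio_neg_natCast {ι : Type} [Fintype ι] (D : DominatedExpSum ι) {m k : ℕ} (hk : k ≤ m)
    (f : Fin k → ι) : D.ratio f (-(m : ℂ)) = D.β ^ (m - k) * ∏ j, D.w (f j) := by
  rw [ratio, neg_neg, cpow_natCast, pow_sub₀ _ D.β_ne_zero hk]
  ring

theorem powSum_eq {κ : Type} [Fintype κ] [DecidableEq κ] {x₀ : κ} (v e : κ → ℂ)
    (D : DominatedExpSum {x // x ≠ x₀}) (hc : (D.c : ℂ) = e x₀) (hβ : (D.β : ℂ) = v x₀)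
    (hd : ∀ i, D.d i = e i) (hw : ∀ i, D.w i = v i) (m : ℕ) (φ : ℂ → ℂ) :
    D.powSum m φ = ∑ g : Fin m → κ, (∏ j, e (g j)) * φ (∏ j, v (g j)) := by
  rw [sum_prod_eq_sum_choose x₀, powSum]
  refine Finset.sum_congr rfl fun k hk ↦ Finset.sum_congr rfl fun f _ ↦ ?_
  have hkm := Nat.lt_succ_iff.1 (Finset.mem_range.1 hk)
  rw [D.ratio_neg_natCast hkm, binomPoly_natCast, coef, ← hβ, ← hc, pow_sub₀ _ D.c_ne_zero hkm]
  simp only [hd, hw]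
  ring

theorem ratio_ne_one {κ : Type} [Fintype κ] [DecidableEq κ] {x₀ : κ} (v : κ → ℂ)
    (D : DominatedExpSum {x // x ≠ x₀}) (hβ : (D.β : ℂ) = v x₀) (hw : ∀ i, D.w i = v i) {m : ℕ}
    (h : ∀ g : Fin m → κ, ∏ j, v (g j) ≠ 1) {k : ℕ} (hk : k ≤ m) (f : Fin k → {x // x ≠ x₀}) :
    D.ratio f (-(m : ℂ)) ≠ 1 := by
  obtain ⟨l, rfl⟩ := Nat.exists_eq_add_of_le hk
  -- pad the tuple with copies of the dominant index
  have := h (Fin.append (fun j ↦ (f j : κ)) fun _ ↦ x₀)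
  rw [D.ratio_neg_natCast hk, Nat.add_sub_cancel_left]
  rw [Fin.prod_univ_add] at this
  simpa [hβ, hw, mul_comm] using this

end DominatedExpSum

end Analysis

section Algebra

open Polynomial

/-! ### The characteristic polynomial -/

/-- The characteristic polynomial `X ^ ℓ - X ^ (ℓ - 1) - ⋯ - X - 1` of the recurrence. -/
noncomputable def fibPoly (ℓ : ℕ) : ℤ[X] := X ^ ℓ - ∑ i ∈ Finset.range ℓ, X ^ i

theorem degree_sum_X_pow_lt (ℓ : ℕ) : (∑ i ∈ Finset.range ℓ, (X : ℤ[X]) ^ i).degree < ℓ := by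
  refine (degree_sum_le _ _).trans_lt ((Finset.sup_lt_iff (WithBot.bot_lt_coe ℓ)).2 fun i hi ↦ ?_)
  rw [degree_X_pow]
  exact WithBot.coe_lt_coe.2 (Finset.mem_range.1 hi)

theorem fibPoly_monic (ℓ : ℕ) : (fibPoly ℓ).Monic :=
  (monic_X_pow ℓ).sub_of_left (by simpa using degree_sum_X_pow_lt ℓ)

theorem natDegree_fibPoly (ℓ : ℕ) : (fibPoly ℓ).natDegree = ℓ := by
  refine natDegree_eq_of_degree_eq_some ?_
  rw [fibPoly, degree_sub_eq_left_of_degree_lt (by simpa using degree_sum_X_pow_lt ℓ),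
    degree_X_pow]

theorem aeval_fibPoly {R : Type*} [CommRing R] (ℓ : ℕ) (x : R) :
    aeval x (fibPoly ℓ) = x ^ ℓ - ∑ i ∈ Finset.range ℓ, x ^ i := by
  simp [fibPoly]

theorem coeff_zero_fibPoly {ℓ : ℕ} (hℓ : 2 ≤ ℓ) : (fibPoly ℓ).coeff 0 = -1 := by
  obtain ⟨t, rfl⟩ := Nat.exists_eq_add_of_le' hℓ
  rw [coeff_zero_eq_eval_zero, fibPoly, eval_sub, eval_finsetSum, Finset.sum_range_succ']
  simp

/-- On the positive reals, the polynomial `fibPoly ℓ` is positive to the right of every point where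
it is nonnegative, because `x ^ (-ℓ) * fibPoly ℓ x` is strictly increasing. -/
theorem sum_pow_lt_of_lt {ℓ : ℕ} (hℓ : 0 < ℓ) {x y : ℝ} (hx : 0 < x) (hxy : x < y)
    (h : ∑ i ∈ Finset.range ℓ, x ^ i ≤ x ^ ℓ) : ∑ i ∈ Finset.range ℓ, y ^ i < y ^ ℓ := by
  have h1 : x ^ ℓ * ∑ i ∈ Finset.range ℓ, y ^ i < y ^ ℓ * ∑ i ∈ Finset.range ℓ, x ^ i := by
    rw [Finset.mul_sum, Finset.mul_sum]
    refine Finset.sum_lt_sum_of_nonempty (Finset.nonempty_range_iff.2 hℓ.ne') fun i hi ↦ ?_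
    obtain ⟨k, hk⟩ := Nat.exists_eq_add_of_lt (Finset.mem_range.1 hi)
    have hy := hx.trans hxy
    calc x ^ ℓ * y ^ i = (x ^ i * y ^ i) * x ^ (k + 1) := by rw [hk]; ring
      _ < (x ^ i * y ^ i) * y ^ (k + 1) := by gcongr
      _ = y ^ ℓ * x ^ i := by rw [hk]; ring
  have h2 : 0 < x ^ ℓ := by positivity
  have h3 : 0 < y ^ ℓ := by have := hx.trans hxy; positivity
  nlinarith

/-- The dominant root is a Pisot number. For a root `z` with `r = ‖z‖ ≥ 1`, the triangle inequality
in `z ^ ℓ = ∑ z ^ i` and in `2 z ^ ℓ = z ^ (ℓ + 1) + 1` gives opposite bounds, so equality holds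
in the latter, `z = r` is real, and `r` is the only positive root. -/
theorem exists_dominant_root {ℓ : ℕ} (hℓ : 2 ≤ ℓ) : ∃ β : ℝ, 1 < β ∧
    β ^ ℓ = ∑ i ∈ Finset.range ℓ, β ^ i ∧
    ∀ z : ℂ, z ^ ℓ = ∑ i ∈ Finset.range ℓ, z ^ i → z ≠ β → ‖z‖ < 1 := by
  have hℓ' : (2 : ℝ) ≤ ℓ := by exact_mod_cast hℓ
  obtain ⟨β, ⟨h1, -⟩, hβ⟩ : (0 : ℝ) ∈ (fun x : ℝ ↦ x ^ ℓ - ∑ i ∈ Finset.range ℓ, x ^ i) ''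
      Set.Icc 1 2 := by
    refine intermediate_value_Icc one_le_two (by fun_prop) ⟨by simp; linarith, ?_⟩
    have := geom_sum_mul (2 : ℝ) ℓ
    linarith
  have hβ : β ^ ℓ = ∑ i ∈ Finset.range ℓ, β ^ i := sub_eq_zero.1 hβ
  have h1 : 1 < β := by
    refine lt_of_le_of_ne h1 ?_
    rintro rfl
    simp at hβ
    linarith
  refine ⟨β, h1, hβ, fun z hz hzβ ↦ ?_⟩
  by_contra! hr
  set r := ‖z‖
  have hr0 : 0 < r := by linarith
  have hle : r ^ ℓ ≤ ∑ i ∈ Finset.range ℓ, r ^ i := by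
    calc r ^ ℓ = ‖∑ i ∈ Finset.range ℓ, z ^ i‖ := by rw [← hz, norm_pow]
      _ ≤ ∑ i ∈ Finset.range ℓ, ‖z ^ i‖ := norm_sum_le _ _
      _ = _ := by simp [r]
  -- multiplying the equation by `z - 1` leaves only three terms
  have hz2 : 2 * z ^ ℓ = z ^ (ℓ + 1) + 1 := by
    have := geom_sum_mul z ℓ
    rw [← hz] at this
    linear_combination -this
  have hn2 : ‖z ^ (ℓ + 1) + 1‖ = 2 * r ^ ℓ := by rw [← hz2, norm_mul, norm_pow]; simp [r]
  have hge : r ^ (ℓ + 1) + 1 ≤ 2 * r ^ ℓ := by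
    have := geom_sum_mul r ℓ
    have h3 : 0 ≤ (∑ i ∈ Finset.range ℓ, r ^ i - r ^ ℓ) * (r - 1) :=
      mul_nonneg (by linarith) (by linarith)
    linear_combination h3 + this
  have heq : ‖z ^ (ℓ + 1) + 1‖ = ‖z ^ (ℓ + 1)‖ + ‖(1 : ℂ)‖ := by
    refine le_antisymm (norm_add_le _ _) ?_
    rw [hn2, norm_pow, norm_one]
    exact hge
  have hpos : z ^ (ℓ + 1) = (r : ℂ) ^ (ℓ + 1) := by
    have := (sameRay_iff_norm_add.2 heq).norm_smul_eq
    rw [norm_pow, norm_one, one_smul] at this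
    rw [← this]
    simp [r]
  have hpos' : z ^ ℓ = (r : ℂ) ^ ℓ := by
    have h3 : r ^ (ℓ + 1) + 1 = 2 * r ^ ℓ := by
      rw [hn2, norm_pow, norm_one] at heq
      exact heq.symm
    have h4 : (r : ℂ) ^ (ℓ + 1) + 1 = 2 * r ^ ℓ := by exact_mod_cast h3
    rw [hpos, h4] at hz2
    exact mul_left_cancel₀ two_ne_zero hz2
  have hr0' : (r : ℂ) ≠ 0 := by exact_mod_cast hr0.ne'
  have hzr : z = r := by
    rw [pow_succ, pow_succ, hpos'] at hpos
    exact mul_left_cancel₀ (pow_ne_zero _ hr0') hpos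
  have hrr : r ^ ℓ = ∑ i ∈ Finset.range ℓ, r ^ i := by
    rw [hzr] at hz
    exact_mod_cast hz
  have hne : r ≠ β := fun h ↦ hzβ (by rw [hzr, h])
  rcases lt_or_gt_of_ne hne with h | h
  · exact (sum_pow_lt_of_lt (by omega) hr0 h hrr.ge).ne hβ.symm
  · exact (sum_pow_lt_of_lt (by omega) (by linarith) h hβ.ge).ne hrr.symm

/-- The dominant root is simple. -/
theorem aeval_derivative_fibPoly_pos {ℓ : ℕ} (hℓ : 0 < ℓ) {β : ℝ} (hβ : 0 < β)
    (h : β ^ ℓ = ∑ i ∈ Finset.range ℓ, β ^ i) : 0 < aeval β (derivative (fibPoly ℓ)) := by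
  have key : β * aeval β (derivative (fibPoly ℓ)) =
      ∑ i ∈ Finset.range ℓ, ((ℓ : ℝ) - i) * β ^ i := by
    have h1 : ∀ i : ℕ, β * ((i : ℝ) * β ^ (i - 1)) = i * β ^ i := by
      rintro (_ | i)
      · simp
      · rw [Nat.add_sub_cancel, pow_succ]; ring
    simp only [fibPoly, derivative_X_pow, map_sub, map_mul,
      map_sum, map_natCast, map_pow, aeval_X, mul_sub, Finset.mul_sum, h1, sub_mul,
      Finset.sum_sub_distrib]
    rw [← Finset.mul_sum, h]
  have hpos : 0 < ∑ i ∈ Finset.range ℓ, ((ℓ : ℝ) - i) * β ^ i := by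
    refine Finset.sum_pos (fun i hi ↦ ?_) (Finset.nonempty_range_iff.2 hℓ.ne')
    have : (i : ℝ) < ℓ := by exact_mod_cast Finset.mem_range.1 hi
    have := sub_pos.2 this
    positivity
  rw [← key] at hpos
  exact (pos_iff_pos_of_mul_pos hpos).1 hβ

/-- Otherwise the constant coefficient, up to sign the product of the roots, would be an integer of
absolute value less than `1`. -/
theorem exists_root_one_le_norm {h : ℤ[X]} (hm : h.Monic) (hd : h.natDegree ≠ 0)
    (h0 : h.coeff 0 ≠ 0) : ∃ z : ℂ, aeval z h = 0 ∧ 1 ≤ ‖z‖ := by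
  by_contra! hlt
  have hmC : (h.map (algebraMap ℤ ℂ)).Monic := hm.map _
  have hprod := (IsAlgClosed.splits (h.map (algebraMap ℤ ℂ))).coeff_zero_eq_prod_roots_of_monic hmC
  have hnorm : ‖(h.map (algebraMap ℤ ℂ)).coeff 0‖ < 1 := by
    obtain ⟨z, hz⟩ := IsAlgClosed.exists_aeval_eq_zero ℂ h (by
      rw [degree_eq_natDegree hm.ne_zero]; exact_mod_cast hd)
    have hroot : ∀ z, z ∈ (h.map (algebraMap ℤ ℂ)).roots ↔ aeval z h = 0 := fun z ↦ by
      rw [mem_roots hmC.ne_zero, IsRoot.def, eval_map_algebraMap]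
    obtain ⟨t, ht⟩ := Multiset.exists_cons_of_mem ((hroot z).2 hz)
    have hle : ∀ s : Multiset ℂ, (∀ x ∈ s, ‖x‖ < 1) → ‖s.prod‖ ≤ 1 := by
      intro s
      induction s using Multiset.induction_on with
      | empty => simp
      | cons x s ih =>
        intro hs
        rw [Multiset.prod_cons, norm_mul]
        exact mul_le_one₀ (hs x (Multiset.mem_cons_self _ _)).le (norm_nonneg _)
          (ih fun y hy ↦ hs y (Multiset.mem_cons_of_mem hy))
    have ht1 := hle t fun x hx ↦ hlt x ((hroot x).1 (ht ▸ Multiset.mem_cons_of_mem hx))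
    rw [hprod, norm_mul, norm_pow, norm_neg, norm_one, one_pow, one_mul, ht, Multiset.prod_cons,
      norm_mul]
    exact mul_lt_one_of_nonneg_of_lt_one_left (norm_nonneg _) (hlt z hz) ht1
  rw [coeff_map, eq_intCast, Complex.norm_intCast] at hnorm
  have : |h.coeff 0| < 1 := by exact_mod_cast hnorm
  exact h0 (Int.abs_lt_one_iff.1 this)

/-- Both factors of a proper factorization would have a root outside the open unit disc, and hence
the dominant root, which is simple. -/
theorem irreducible_fibPoly {ℓ : ℕ} (hℓ : 2 ≤ ℓ) : Irreducible (fibPoly ℓ) := by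
  obtain ⟨β, hβ1, hβ, hdom⟩ := exists_dominant_root hℓ
  rw [(fibPoly_monic ℓ).irreducible_iff_natDegree]
  refine ⟨fun h ↦ ?_, fun f g hf hg hfg ↦ ?_⟩
  · have := natDegree_fibPoly ℓ
    rw [h, natDegree_one] at this
    omega
  · by_contra! hne
    have h0 : f.coeff 0 * g.coeff 0 = -1 := by rw [← mul_coeff_zero, hfg, coeff_zero_fibPoly hℓ]
    have hne0 : f.coeff 0 * g.coeff 0 ≠ 0 := by rw [h0]; norm_num
    have hroot : ∀ h : ℤ[X], h ∣ fibPoly ℓ → h.Monic → h.natDegree ≠ 0 → h.coeff 0 ≠ 0 →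
        aeval β h = 0 := by
      intro h hdvd hm hd hc
      obtain ⟨z, hz, hz1⟩ := exists_root_one_le_norm hm hd hc
      have hzp : aeval z (fibPoly ℓ) = 0 := aeval_eq_zero_of_dvd_aeval_eq_zero hdvd hz
      rw [aeval_fibPoly, sub_eq_zero] at hzp
      have hzβ : z = β := by
        by_contra hne
        exact absurd (hdom z hzp hne) (not_lt.2 hz1)
      rw [hzβ, show (β : ℂ) = algebraMap ℝ ℂ β from rfl, aeval_algebraMap_apply] at hz
      exact (map_eq_zero _).1 hz
    have hfβ := hroot f ⟨g, hfg.symm⟩ hf hne.1 (left_ne_zero_of_mul hne0)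
    have hgβ := hroot g ⟨f, by rw [mul_comm, hfg]⟩ hg hne.2
      (right_ne_zero_of_mul hne0)
    have := aeval_derivative_fibPoly_pos (by omega) (by linarith) hβ
    rw [← hfg, derivative_mul, map_add, map_mul, map_mul, hfβ, hgβ] at this
    simp at this

/-! ### The Binet formula and the Galois action on the roots -/

theorem genFib_add_two (ℓ n : ℕ) :
    genFib ℓ (n + 2) = ∑ i ∈ Finset.range ℓ, genFib ℓ (n + 1 - i) := by
  rw [genFib, Finset.sum_range]

theorem genFib_pos {ℓ : ℕ} (hℓ : 2 ≤ ℓ) (n : ℕ) : 0 < genFib ℓ (n + 1) := by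
  induction n with
  | zero => rw [genFib]; exact one_pos
  | succ n ih =>
    rw [genFib_add_two]
    refine ih.trans_le ?_
    exact Finset.single_le_sum (f := fun i ↦ genFib ℓ (n + 1 - i)) (fun _ _ ↦ Nat.zero_le _)
      (Finset.mem_range.2 (show 0 < ℓ by omega))

/-- The characteristic polynomial with rational coefficients. -/
noncomputable def fibPolyQ (ℓ : ℕ) : ℚ[X] := (fibPoly ℓ).map (algebraMap ℤ ℚ)

theorem fibPolyQ_monic (ℓ : ℕ) : (fibPolyQ ℓ).Monic := (fibPoly_monic ℓ).map _

theorem natDegree_fibPolyQ (ℓ : ℕ) : (fibPolyQ ℓ).natDegree = ℓ := by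
  rw [fibPolyQ, (fibPoly_monic ℓ).natDegree_map, natDegree_fibPoly]

theorem irreducible_fibPolyQ {ℓ : ℕ} (hℓ : 2 ≤ ℓ) : Irreducible (fibPolyQ ℓ) :=
  ((fibPoly_monic ℓ).irreducible_iff_irreducible_map_fraction_map).1 (irreducible_fibPoly hℓ)

theorem aeval_fibPolyQ {R : Type*} [CommRing R] [Algebra ℚ R] (ℓ : ℕ) (x : R) :
    aeval x (fibPolyQ ℓ) = x ^ ℓ - ∑ i ∈ Finset.range ℓ, x ^ i := by
  rw [fibPolyQ, aeval_map_algebraMap, aeval_fibPoly]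

section SplittingField

variable {ℓ : ℕ} {L : Type} [Field L] [Algebra ℚ L]

theorem rootSet_pow_eq (x : (fibPolyQ ℓ).rootSet L) :
    (x : L) ^ ℓ = ∑ i ∈ Finset.range ℓ, (x : L) ^ i := by
  have := aeval_eq_zero_of_mem_rootSet x.2
  rwa [aeval_fibPolyQ, sub_eq_zero] at this

/-- The coefficient of `x ^ n` in the Binet formula for `genFib ℓ (n + 1)`. -/
noncomputable def binetCoeff (ℓ : ℕ) {R : Type*} [Field R] [Algebra ℚ R] (x : R) : R :=
  x ^ (ℓ - 1) / aeval x (derivative (fibPolyQ ℓ))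

theorem map_binetCoeff {R S : Type*} [Field R] [Algebra ℚ R] [Field S] [Algebra ℚ S]
    (σ : R →ₐ[ℚ] S) (x : R) : σ (binetCoeff ℓ x) = binetCoeff ℓ (σ x) := by
  rw [binetCoeff, binetCoeff, map_div₀, map_pow, aeval_algHom_apply]

theorem derivative_ne_zero (hℓ : 2 ≤ ℓ) (x : (fibPolyQ ℓ).rootSet L) :
    aeval (x : L) (derivative (fibPolyQ ℓ)) ≠ 0 :=
  (irreducible_fibPolyQ hℓ).separable.aeval_derivative_ne_zero (aeval_eq_zero_of_mem_rootSet x.2)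

theorem rootSet_ne_zero (hℓ : 2 ≤ ℓ) (x : (fibPolyQ ℓ).rootSet L) : (x : L) ≠ 0 := by
  intro h
  have := rootSet_pow_eq x
  obtain ⟨t, rfl⟩ := Nat.exists_eq_add_of_le' hℓ
  rw [h, Finset.sum_range_succ'] at this
  simp at this

theorem binetCoeff_ne_zero (hℓ : 2 ≤ ℓ) (x : (fibPolyQ ℓ).rootSet L) :
    binetCoeff ℓ (x : L) ≠ 0 :=
  div_ne_zero (pow_ne_zero _ (rootSet_ne_zero hℓ x)) (derivative_ne_zero hℓ x)

/-- The permutation of the roots induced by an automorphism. -/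
noncomputable def rootPerm (σ : L ≃ₐ[ℚ] L) : Equiv.Perm ((fibPolyQ ℓ).rootSet L) :=
  (σ.toEquiv.subtypeEquiv fun x ↦ by
    rw [mem_rootSet, mem_rootSet, show aeval (σ.toEquiv x) (fibPolyQ ℓ) = σ (aeval x (fibPolyQ ℓ))
      from aeval_algHom_apply (σ : L →ₐ[ℚ] L) x _, EmbeddingLike.map_eq_zero_iff (f := σ)])

theorem coe_rootPerm (σ : L ≃ₐ[ℚ] L) (x : (fibPolyQ ℓ).rootSet L) :
    (rootPerm σ x : L) = σ x := rfl

variable [IsSplittingField ℚ L (fibPolyQ ℓ)]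

theorem nodal_rootSet (hℓ : 2 ≤ ℓ) :
    Lagrange.nodal Finset.univ (fun x : (fibPolyQ ℓ).rootSet L ↦ (x : L)) =
      (fibPolyQ ℓ).map (algebraMap ℚ L) := by
  classical
  have hsep := ((irreducible_fibPolyQ hℓ).separable).map (f := algebraMap ℚ L)
  have hs := IsSplittingField.splits L (fibPolyQ ℓ)
  rw [Lagrange.nodal_eq]
  conv_rhs => rw [hs.eq_prod_roots_of_monic ((fibPolyQ_monic ℓ).map _)]
  rw [← Finset.prod_subtype ((fibPolyQ ℓ).aroots L).toFinset (p := (· ∈ (fibPolyQ ℓ).rootSet L))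
    (fun x ↦ by rw [rootSet_def]; rfl) (fun x ↦ X - C x)]
  rw [Finset.prod, Multiset.toFinset_val, (nodup_roots hsep).dedup]

theorem card_rootSet (hℓ : 2 ≤ ℓ) : Fintype.card ((fibPolyQ ℓ).rootSet L) = ℓ := by
  rw [card_rootSet_eq_natDegree (irreducible_fibPolyQ hℓ).separable (IsSplittingField.splits L _),
    natDegree_fibPolyQ]

theorem prod_sub_rootSet (hℓ : 2 ≤ ℓ) (z : L) :
    ∏ x : (fibPolyQ ℓ).rootSet L, (z - x) = z ^ ℓ - ∑ i ∈ Finset.range ℓ, z ^ i := by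
  have := Lagrange.eval_nodal (s := Finset.univ)
    (v := fun x : (fibPolyQ ℓ).rootSet L ↦ (x : L)) (x := z)
  rw [← this, nodal_rootSet hℓ, eval_map_algebraMap, aeval_fibPolyQ]

/-- Euler's formula for the roots of a separable polynomial. -/
theorem sum_pow_div_derivative (hℓ : 2 ≤ ℓ) {k : ℕ} (hk : k < ℓ) :
    ∑ x : (fibPolyQ ℓ).rootSet L, (x : L) ^ k / aeval (x : L) (derivative (fibPolyQ ℓ)) =
      if k = ℓ - 1 then 1 else 0 := by
  classical
  have h := Lagrange.coeff_eq_sum (s := Finset.univ) (v := fun x : (fibPolyQ ℓ).rootSet L ↦ (x : L))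
    Subtype.val_injective.injOn (P := X ^ k) (by
      rw [degree_X_pow, Finset.card_univ, card_rootSet hℓ]
      exact WithBot.coe_lt_coe.2 hk)
  rw [Finset.card_univ, card_rootSet hℓ, coeff_X_pow] at h
  simp only [eq_comm (a := ℓ - 1)] at h
  rw [h]
  refine Finset.sum_congr rfl fun x _ ↦ ?_
  rw [eval_pow, eval_X, ← Lagrange.eval_nodal,
    ← Lagrange.eval_nodal_derivative_eval_node_eq (Finset.mem_univ x), nodal_rootSet hℓ,
    derivative_map, eval_map_algebraMap]

/-- Both sides satisfy the same recurrence and start with `ℓ - 1` zeros followed by a `1`. -/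
theorem genFib_eq_sum_div (t n : ℕ) (h : ℓ = t + 2) :
    (genFib ℓ n : L) = ∑ x : (fibPolyQ ℓ).rootSet L,
      (x : L) ^ (n + t) / aeval (x : L) (derivative (fibPolyQ ℓ)) := by
  have hℓ : 2 ≤ ℓ := by omega
  induction n using Nat.strong_induction_on with
  | _ n ih =>
    match n with
    | 0 =>
      rw [sum_pow_div_derivative hℓ (by omega), if_neg (by omega), genFib, Nat.cast_zero]
    | 1 => rw [sum_pow_div_derivative hℓ (by omega), if_pos (by omega), genFib, Nat.cast_one]
    | n + 2 =>
      have hrec : ∀ x : (fibPolyQ ℓ).rootSet L, (x : L) ^ (n + 2 + t) =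
          ∑ i ∈ Finset.range ℓ, (x : L) ^ (n + 1 + t - i) := fun x ↦ by
        rw [show n + 2 + t = n + ℓ by omega, pow_add, rootSet_pow_eq, ← Finset.sum_range_reflect,
          Finset.mul_sum]
        refine Finset.sum_congr rfl fun i hi ↦ ?_
        rw [← pow_add]
        congr 1
        have := Finset.mem_range.1 hi
        omega
      simp only [hrec, Finset.sum_div]
      rw [genFib_add_two, Nat.cast_sum, Finset.sum_comm]
      refine Finset.sum_congr rfl fun i hi ↦ ?_
      have hi := Finset.mem_range.1 hi
      rcases le_or_gt i (n + 1) with hin | hin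
      · rw [ih _ (by omega), show n + 1 - i + t = n + 1 + t - i by omega]
      · -- the index `n + 1 - i` is truncated to `0`
        rw [sum_pow_div_derivative hℓ (by omega), if_neg (by omega),
          Nat.sub_eq_zero_of_le hin.le, genFib, Nat.cast_zero]

/-- The Binet formula. -/
theorem genFib_succ_eq (hℓ : 2 ≤ ℓ) (n : ℕ) :
    (genFib ℓ (n + 1) : L) =
      ∑ x : (fibPolyQ ℓ).rootSet L, binetCoeff ℓ (x : L) * (x : L) ^ n := by
  obtain ⟨t, ht⟩ := Nat.exists_eq_add_of_le' hℓ
  rw [genFib_eq_sum_div t _ ht]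
  refine Finset.sum_congr rfl fun x _ ↦ ?_
  rw [binetCoeff, show n + 1 + t = ℓ - 1 + n by omega, pow_add]
  ring

/-- The sum is fixed by the Galois group, which permutes the tuples of roots. -/
theorem exists_rat_eq_sum_prod (hℓ : 2 ≤ ℓ) (m N : ℕ) : ∃ q : ℚ,
    algebraMap ℚ L q = ∑ g : Fin m → (fibPolyQ ℓ).rootSet L,
      (∏ j, binetCoeff ℓ (g j : L)) * ((∏ j, (g j : L)) ^ N / (1 - ∏ j, (g j : L))) := by
  have := IsGalois.of_separable_splitting_field (E := L) (irreducible_fibPolyQ hℓ).separable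
  have := IsSplittingField.finiteDimensional L (fibPolyQ ℓ)
  rw [← Set.mem_range, ← IntermediateField.mem_bot, IsGalois.mem_bot_iff_fixed]
  intro σ
  rw [map_sum]
  refine Fintype.sum_equiv (Equiv.arrowCongr (Equiv.refl _) (rootPerm σ)) _ _ fun g ↦ ?_
  have h : ∀ y : L, σ (binetCoeff ℓ y) = binetCoeff ℓ (σ y) := map_binetCoeff (σ : L →ₐ[ℚ] L)
  simp [map_prod, coe_rootPerm, h]

/-- The Galois group is transitive on the roots. -/
theorem exists_rootPerm_eq (hℓ : 2 ≤ ℓ) (x y : (fibPolyQ ℓ).rootSet L) :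
    ∃ σ : L ≃ₐ[ℚ] L, rootPerm σ x = y := by
  have := IsGalois.of_separable_splitting_field (E := L) (irreducible_fibPolyQ hℓ).separable
  have hmin : ∀ z : (fibPolyQ ℓ).rootSet L, fibPolyQ ℓ = minpoly ℚ (z : L) := fun z ↦
    minpoly.eq_of_irreducible_of_monic (irreducible_fibPolyQ hℓ)
      (aeval_eq_zero_of_mem_rootSet z.2) (fibPolyQ_monic ℓ)
  obtain ⟨σ, hσ⟩ := isConjRoot_iff_exists_algEquiv.1
    (show IsConjRoot ℚ (y : L) (x : L) from (hmin y).symm.trans (hmin x))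
  exact ⟨σ, Subtype.ext hσ⟩

variable (φ : L →ₐ[ℚ] ℂ)

theorem exists_rootSet_eq (hℓ : 2 ≤ ℓ) {z : ℂ} (hz : z ^ ℓ = ∑ i ∈ Finset.range ℓ, z ^ i) :
    ∃ x : (fibPolyQ ℓ).rootSet L, φ x = z := by
  have h := congrArg (fun p ↦ eval z (p.map (φ : L →+* ℂ))) (nodal_rootSet (L := L) hℓ)
  simp only [Lagrange.nodal_eq, Polynomial.map_prod, eval_prod, Polynomial.map_map] at h
  rw [show (φ : L →+* ℂ).comp (algebraMap ℚ L) = algebraMap ℚ ℂ from φ.comp_algebraMap,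
    eval_map_algebraMap, aeval_fibPolyQ, hz, sub_self, Finset.prod_eq_zero_iff] at h
  obtain ⟨x, -, hx⟩ := h
  exact ⟨x, (sub_eq_zero.1 (by simpa using hx)).symm⟩

/-- The constant coefficient of the characteristic polynomial is `-1`. -/
theorem prod_norm_rootSet (hℓ : 2 ≤ ℓ) : ∏ x : (fibPolyQ ℓ).rootSet L, ‖φ x‖ = 1 := by
  have h := congrArg (fun y ↦ ‖φ y‖) (prod_sub_rootSet (L := L) hℓ 0)
  obtain ⟨t, rfl⟩ := Nat.exists_eq_add_of_le' hℓ
  simpa [map_prod, norm_prod, Finset.sum_range_succ'] using h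

/-- There is no nontrivial multiplicative relation between the conjugates of a Pisot number: in a
product of roots that equals `1`, all the roots occur equally often. -/
theorem exists_card_eq_of_prod_eq_one (hℓ : 2 ≤ ℓ)
    [DecidableEq ((fibPolyQ ℓ).rootSet L)] {x₀ : (fibPolyQ ℓ).rootSet L}
    (hx₀ : ∀ x : (fibPolyQ ℓ).rootSet L, x ≠ x₀ → ‖φ x‖ < 1) {m : ℕ}
    {g : Fin m → (fibPolyQ ℓ).rootSet L} (hg : ∏ j, (g j : L) = 1) :
    ∀ x, (Finset.univ.filter fun j ↦ g j = x).card = m / ℓ := by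
  set cnt : (fibPolyQ ℓ).rootSet L → ℕ := fun x ↦ (Finset.univ.filter fun j ↦ g j = x).card
    with hcnt
  have : Nonempty ((fibPolyQ ℓ).rootSet L) := ⟨x₀⟩
  obtain ⟨x₁, hx₁⟩ := Finite.exists_max cnt
  -- after applying `σ`, the dominant root `x₀` has the maximal multiplicity
  obtain ⟨σ, hσ⟩ := exists_rootPerm_eq hℓ x₁ x₀
  have h1 : ∏ x, ‖φ (rootPerm σ x)‖ ^ cnt x = 1 := by
    have h := congrArg (fun y ↦ ‖φ (σ y)‖) hg
    rw [← Finset.prod_fiberwise Finset.univ g] at h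
    have h' : ∀ x, ∏ j ∈ Finset.univ.filter (fun j ↦ g j = x), (g j : L) = (x : L) ^ cnt x :=
      fun x ↦ Finset.prod_eq_pow_card fun j hj ↦ by rw [(Finset.mem_filter.1 hj).2]
    simpa [h', map_prod, norm_prod, coe_rootPerm] using h
  have h2 : ∏ x : (fibPolyQ ℓ).rootSet L, ‖φ (rootPerm σ x)‖ ^ cnt x₁ = 1 := by
    rw [Finset.prod_pow, Equiv.prod_comp (rootPerm σ) (fun x ↦ ‖φ x‖), prod_norm_rootSet φ hℓ,
      one_pow]
  -- the quotient of the two relations does not involve `x₀`, and all other factors are at most `1`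
  have h3 : ∏ x, ‖φ (rootPerm σ x)‖ ^ (cnt x₁ - cnt x) = 1 := by
    rw [← h2, ← mul_one (∏ x, ‖φ (rootPerm σ x)‖ ^ (cnt x₁ - cnt x)), ← h1,
      ← Finset.prod_mul_distrib]
    refine Finset.prod_congr rfl fun x _ ↦ ?_
    rw [← pow_add, Nat.sub_add_cancel (hx₁ x)]
  have hlt : ∀ x, x ≠ x₁ → ‖φ (rootPerm σ x)‖ < 1 := fun x hx ↦
    hx₀ _ fun h ↦ hx ((rootPerm σ).injective (h.trans hσ.symm))
  have hle : ∀ x, ‖φ (rootPerm σ x)‖ ^ (cnt x₁ - cnt x) ≤ 1 := fun x ↦ by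
    by_cases hx : x = x₁
    · simp [hx]
    · exact pow_le_one₀ (norm_nonneg _) (hlt x hx).le
  have heq : ∀ x, cnt x = cnt x₁ := by
    intro x
    by_contra hne
    have hx : x ≠ x₁ := fun h ↦ hne (by rw [h])
    rw [← Finset.mul_prod_erase _ _ (Finset.mem_univ x)] at h3
    have h4 : ‖φ (rootPerm σ x)‖ ^ (cnt x₁ - cnt x) < 1 :=
      pow_lt_one₀ (norm_nonneg _) (hlt x hx) (by have := hx₁ x; omega)
    exact (mul_lt_one_of_nonneg_of_lt_one_left (by positivity) h4
      (Finset.prod_le_one (fun _ _ ↦ by positivity) fun x _ ↦ hle x)).ne h3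
  have hsum : m = ℓ * cnt x₁ := by
    have := Finset.card_eq_sum_card_fiberwise (s := Finset.univ) (t := Finset.univ) (f := g)
      (by simp)
    rw [Finset.card_univ, Fintype.card_fin] at this
    rw [this]
    simp only [← hcnt]
    rw [Finset.sum_congr rfl fun x _ ↦ heq x, Finset.sum_const, Finset.card_univ, card_rootSet hℓ,
      smul_eq_mul]
  intro x
  exact (heq x).trans (Nat.div_eq_of_eq_mul_right (by omega) hsum).symm

end SplittingField

/-! ### Poles and values of the zeta function -/

/-- The generalized Fibonacci numbers as a dominated exponential sum, indexed by the roots `x` of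
the characteristic polynomial other than the dominant one. -/
theorem exists_dominatedExpSum {ℓ : ℕ} (hℓ : 2 ≤ ℓ) {L : Type} [Field L] [Algebra ℚ L]
    [IsSplittingField ℚ L (fibPolyQ ℓ)] [DecidableEq ((fibPolyQ ℓ).rootSet L)] (φ : L →ₐ[ℚ] ℂ) :
    ∃ x₀ : (fibPolyQ ℓ).rootSet L, (∀ x : (fibPolyQ ℓ).rootSet L, x ≠ x₀ → ‖φ x‖ < 1) ∧
      ∃ D : DominatedExpSum {x : (fibPolyQ ℓ).rootSet L // x ≠ x₀},
        (∀ n, D.a n = genFib ℓ (n + 1)) ∧ (D.c : ℂ) = φ (binetCoeff ℓ (x₀ : L)) ∧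
        (D.β : ℂ) = φ x₀ ∧ (∀ i, D.d i = φ (binetCoeff ℓ (i : L))) ∧ ∀ i, D.w i = φ i := by
  obtain ⟨β, hβ1, hβ, hdom⟩ := exists_dominant_root hℓ
  obtain ⟨x₀, hx₀⟩ := exists_rootSet_eq φ hℓ (z := β) (by exact_mod_cast hβ)
  have hlt : ∀ x : (fibPolyQ ℓ).rootSet L, x ≠ x₀ → ‖φ x‖ < 1 := fun x hx ↦ by
    refine hdom _ ?_ fun h ↦ hx (Subtype.ext (φ.toRingHom.injective (h.trans hx₀.symm)))
    rw [← map_pow, rootSet_pow_eq, map_sum]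
    simp only [map_pow]
  have hc : ((binetCoeff ℓ β : ℝ) : ℂ) = φ (binetCoeff ℓ (x₀ : L)) := by
    rw [map_binetCoeff, hx₀]
    exact map_binetCoeff (Complex.ofRealAm.restrictScalars ℚ) β
  have hpos : 0 < binetCoeff ℓ β := by
    have h := aeval_derivative_fibPoly_pos (by omega) (by linarith) hβ
    rw [← aeval_map_algebraMap ℚ, ← derivative_map] at h
    exact div_pos (pow_pos (by linarith) _) h
  refine ⟨x₀, hlt, ⟨fun n ↦ genFib ℓ (n + 1), binetCoeff ℓ β, β, fun i ↦ φ (binetCoeff ℓ (i : L)),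
    fun i ↦ φ i, fun n ↦ by exact_mod_cast genFib_pos hℓ n, hpos, hβ1, fun i ↦ (hlt i i.2).le,
    fun n ↦ ?_⟩, fun _ ↦ rfl, hc, hx₀.symm, fun _ ↦ rfl, fun _ ↦ rfl⟩
  have h := congrArg φ (genFib_succ_eq (L := L) hℓ n)
  rw [map_natCast, map_sum, Fintype.sum_eq_add_sum_subtype_ne _ x₀] at h
  simp only [map_mul, map_pow] at h
  rw [hc, ← hx₀, Complex.ofReal_natCast, h]

theorem isGenFibZeta_iff {ℓ : ℕ} {ι : Type} [Fintype ι] {D : DominatedExpSum ι}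
    (ha : ∀ n, D.a n = genFib ℓ (n + 1)) (Z : ℂ → ℂ) : IsGenFibZeta ℓ Z ↔ D.IsContinuation Z := by
  have h : ∀ (n : ℕ) (s : ℂ), (D.a n : ℂ) ^ (-s) = 1 / (genFib ℓ (n + 1) : ℂ) ^ s := fun n s ↦ by
    rw [Complex.cpow_neg, one_div, ha, Complex.ofReal_natCast]
  constructor
  · rintro ⟨h1, h2⟩
    exact ⟨h1, by simpa only [h] using h2⟩
  · rintro ⟨h1, h2⟩
    exact ⟨h1, by simpa only [h] using h2⟩

/-- If the residue at `-m`, a sum over the products of `m` roots that equal `1`, vanishes, then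
there is no such product: all terms of the sum are equal and nonzero. -/
theorem prod_ne_one_of_sum_eq_zero {ℓ : ℕ} (hℓ : 2 ≤ ℓ) {L : Type} [Field L] [Algebra ℚ L]
    [IsSplittingField ℚ L (fibPolyQ ℓ)] (φ : L →ₐ[ℚ] ℂ) {x₀ : (fibPolyQ ℓ).rootSet L}
    (hx₀ : ∀ x : (fibPolyQ ℓ).rootSet L, x ≠ x₀ → ‖φ x‖ < 1) {m : ℕ} {A : ℂ} (hA : A ≠ 0)
    (h : ∑ g : Fin m → (fibPolyQ ℓ).rootSet L, (∏ j, φ (binetCoeff ℓ (g j : L))) *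
      (if ∏ j, φ (g j) = 1 then A else 0) = 0) (g : Fin m → (fibPolyQ ℓ).rootSet L) :
    ∏ j, φ (g j) ≠ 1 := by
  classical
  intro hg
  set B : ℂ := (∏ x : (fibPolyQ ℓ).rootSet L, φ (binetCoeff ℓ (x : L))) ^ (m / ℓ) with hB
  have hB0 : B ≠ 0 := pow_ne_zero _ (Finset.prod_ne_zero_iff.2 fun x _ ↦
    (map_ne_zero φ).2 (binetCoeff_ne_zero hℓ x))
  have hterm : ∀ g : Fin m → (fibPolyQ ℓ).rootSet L, ∏ j, φ (g j) = 1 →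
      ∏ j, φ (binetCoeff ℓ (g j : L)) = B := by
    intro g hg
    rw [← map_prod, map_eq_one_iff φ φ.toRingHom.injective] at hg
    have hcard := exists_card_eq_of_prod_eq_one φ hℓ hx₀ hg
    rw [← Finset.prod_fiberwise Finset.univ g, hB, ← Finset.prod_pow]
    refine Finset.prod_congr rfl fun x _ ↦ ?_
    rw [← hcard x]
    exact Finset.prod_eq_pow_card fun j hj ↦ by rw [(Finset.mem_filter.1 hj).2]
  have hsum : ∑ g : Fin m → (fibPolyQ ℓ).rootSet L, (∏ j, φ (binetCoeff ℓ (g j : L))) *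
      (if ∏ j, φ (g j) = 1 then A else 0) =
      ((Finset.univ.filter fun g : Fin m → (fibPolyQ ℓ).rootSet L ↦
        ∏ j, φ (g j) = 1).card : ℂ) * (B * A) := by
    rw [← nsmul_eq_mul, ← Finset.sum_const, Finset.sum_filter]
    refine Finset.sum_congr rfl fun g _ ↦ ?_
    split_ifs with h1
    · rw [hterm g h1]
    · rw [mul_zero]
  rw [hsum, mul_eq_zero, Nat.cast_eq_zero, Finset.card_eq_zero] at h
  rcases h with h | h
  · exact Finset.notMem_empty g (h ▸ Finset.mem_filter.2 ⟨Finset.mem_univ g, hg⟩)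
  · exact mul_ne_zero hB0 hA h

end Algebra

theorem mainTheorem2 (ℓ : ℕ) (hℓ : 2 ≤ ℓ) :
    (∃! Z : ℂ → ℂ, IsGenFibZeta ℓ Z) ∧
      ∀ Z : ℂ → ℂ, IsGenFibZeta ℓ Z →
        ∀ m : ℕ, 0 < m → ¬ HasPoleAt Z (-(m : ℂ)) → ∃ q : ℚ, Z (-(m : ℂ)) = (q : ℂ) := by
  classical
  obtain ⟨L, _, _, _⟩ : ∃ (L : Type) (_ : Field L) (_ : Algebra ℚ L),
      Polynomial.IsSplittingField ℚ L (fibPolyQ ℓ) :=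
    ⟨_, _, _, Polynomial.IsSplittingField.splittingField (fibPolyQ ℓ)⟩
  have := Polynomial.IsSplittingField.finiteDimensional L (fibPolyQ ℓ)
  let φ : L →ₐ[ℚ] ℂ := IsAlgClosed.lift
  obtain ⟨x₀, hx₀, D, ha, hc, hβ, hd, hw⟩ := exists_dominatedExpSum hℓ φ
  refine ⟨?_, fun Z hZ m _ hm ↦ ?_⟩
  · obtain ⟨Z, hZ⟩ := D.exists_isContinuation
    exact ⟨Z, (isGenFibZeta_iff ha Z).2 hZ, fun Z' hZ' ↦
      ((isGenFibZeta_iff ha Z').1 hZ').unique hZ⟩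
  · rw [isGenFibZeta_iff ha] at hZ
    have hpow := D.powSum_eq (fun x : (fibPolyQ ℓ).rootSet L ↦ φ x)
      (fun x ↦ φ (binetCoeff ℓ (x : L))) hc hβ hd hw m
    have hres := hZ.powSum_eq_zero hm
    rw [hpow] at hres
    have hne := prod_ne_one_of_sum_eq_zero hℓ φ hx₀ (inv_ne_zero D.log_β_ne_zero) hres
    obtain ⟨q, hq⟩ := exists_rat_eq_sum_prod (L := L) hℓ m D.N
    refine ⟨(∑ n ∈ Finset.range D.N, genFib ℓ (n + 1) ^ m : ℕ) + q, ?_⟩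
    rw [hZ.apply_neg_natCast hm fun k hk f ↦ D.ratio_ne_one
      (fun x : (fibPolyQ ℓ).rootSet L ↦ φ x) hβ hw hne hk f, hpow]
    have hq' := congrArg φ hq
    simp only [AlgHom.commutes, map_sum, map_mul, map_prod, map_div₀, map_pow, map_sub,
      map_one] at hq'
    rw [← hq']
    simp [ha]
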